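/- **Setting.** A device-to-device (D2D) coded caching system has $N\ge 1$ files of $L$ bits each and $K$ users, each with a cache of $ML$ bits; put $t=KM/N$. A (one-shot, uncoded-placement) *D2D scheme with subpacketization level $F$* consists of the following. Every file is split, in the same way, into $F$ nonempty packets, possibly of different sizes. Before the demands are known, every user stores some of the packets, of total size exactly $ML$ bits. For every demand vector $(d_1,\dots,d_K)\in[N]^K$ a finite list of messages is broadcast. Each message is sent by one user of a multicast group of $t+1$ users, and is the XOR of $t$ equal-size packets cached by the sender, one for each other user $u$ of the group, namely a packet of file $d_u$ that $u$ has not cached and that all the other users of the group have cached. Every packet of $d_u$ not cached by user $u$ occurs in some message sent by another user whose remaining packets $u$ has cached, and every user $u$ recovers all of file $d_u$ from its cache and the messages. The *rate* is the maximum over all demand vectors of the number of broadcast bits divided by $L$. **Theorem.** Let $(K,t)=(2q+1,2r)$ with integers $1\le r\le q$. Put $$F_{\rm PT}=\sum_{k=1}^{t+1}\alpha_k f_k,\qquad \alpha_k=\begin{cases}2(k-1),&1\le k\le r,\\ t,&r+1\le k\le t+1,\end{cases}\qquad f_k=\binom{q+1}{k-1}\binom{q}{t-k+1},$$ and let $F_{\rm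 JCM}=t\binom{K}{t}$ be the subpacketization level of the Ji–Caire–Molisch (JCM) scheme. Then $F_{\rm PT}\le F_{\rm JCM}$, and there is a positive integer $L_0$ (depending only on $q,r$) such that for every positive multiple $L$ of $L_0$, every $N\ge1$ and $M=tN/K$, there is a D2D scheme with $N$ files of $L$ bits, $K$ users, cache size $ML$ bits, subpacketization level exactly $F_{\rm PT}$, and rate $R=N/M-1$ (the rate of the JCM scheme). Moreover, for every fixed $t=2r$ with $r\ge 1$, $$\lim_{q\to\infty}\frac{F_{\rm PT}}{F_{\rm JCM}}=1-\frac12\cdot\frac{\binom{t}{r}}{2^t},$$ and $\frac12\binom{t}{r}/2^{t}=\Theta(1/\sqrt t)$ as $t=2r\to\infty$, so that the limit is $1-\Theta(1/\sqrt t)$. -/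

import Mathlib

open Filter Topology Asymptotics

/-- A broadcast in a device-to-device system with `N` files, `K` users, and `F` packets per file,
packet `p` having `len p` bits: user `sender` broadcasts the bitwise XOR of the packets in
`packets` (a pair `(n, p)` stands for packet `p` of file `n`), all of which have `size` bits. -/
structure Transmission (N K F : ℕ) (len : Fin F → ℕ) where
  sender : Fin K
  packets : Finset (Fin N × Fin F)
  size : ℕ
  size_eq : ∀ x ∈ packets, len x.2 = size

/-- A device-to-device coded caching scheme with `N` files of `L` bits each, `K` users, uncoded
placement and subpacketization level `F`: every file is split into `F` nonempty packets, of possibly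
different sizes, users cache whole packets, and broadcast XORs of whole cached packets. -/
structure D2DScheme (N K L F : ℕ) where
  /-- number of bits of each packet -/
  len : Fin F → ℕ
  len_pos : ∀ p, 0 < len p
  /-- bit `i` of packet `p` of a file is the bit of that file at position `split ⟨p, i⟩`;
  every bit of the file lies in exactly one packet -/
  split : (Σ p : Fin F, Fin (len p)) ≃ Fin L
  /-- the packets stored by each user, chosen before the demands are known -/
  cache : Fin K → Finset (Fin N × Fin F)
  /-- the broadcasts made when user `k` demands file `d k` -/
  delivery : (Fin K → Fin N) → List (Transmission N K F len)
  /-- a user only uses packets from its own cache to form its broadcasts -/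
  sender_caches : ∀ d, ∀ τ ∈ delivery d, τ.packets ⊆ cache τ.sender

namespace D2DScheme

variable {N K L F : ℕ} (S : D2DScheme N K L F)

/-- The bits of a packet, for the library `W` of files, continued by zeros. -/
def packetBit (W : Fin N → Fin L → ZMod 2) (x : Fin N × Fin F) (i : ℕ) : ZMod 2 :=
  if h : i < S.len x.2 then W x.1 (S.split ⟨x.2, ⟨i, h⟩⟩) else 0

/-- The content of the cache of user `k`. -/
def cacheContent (W : Fin N → Fin L → ZMod 2) (k : Fin K) :
    (x : {x : Fin N × Fin F // x ∈ S.cache k}) → Fin (S.len x.1.2) → ZMod 2 :=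
  fun x i => S.packetBit W x.1 i

/-- The coded message sent in a broadcast: the bitwise XOR of its packets. -/
def message (W : Fin N → Fin L → ZMod 2) (τ : Transmission N K F S.len) :
    Fin τ.size → ZMod 2 :=
  fun i => ∑ x ∈ τ.packets, S.packetBit W x i

/-- The sequence of all coded messages sent for the demands `d`. -/
def received (W : Fin N → Fin L → ZMod 2) (d : Fin K → Fin N) :
    (j : Fin (S.delivery d).length) → Fin ((S.delivery d).get j).size → ZMod 2 :=
  fun j => S.message W ((S.delivery d).get j)

/-- Correctness: for all demands, every user can recover all bits of its demanded file from its
cache and the coded messages, whatever the files are. -/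
def IsCorrect : Prop :=
  ∀ (d : Fin K → Fin N) (k : Fin K),
    ∃ decode :
      ((x : {x : Fin N × Fin F // x ∈ S.cache k}) → Fin (S.len x.1.2) → ZMod 2) →
      ((j : Fin (S.delivery d).length) → Fin ((S.delivery d).get j).size → ZMod 2) →
      (Fin L → ZMod 2),
    ∀ W : Fin N → Fin L → ZMod 2,
      decode (S.cacheContent W k) (S.received W d) = W (d k)

/-- One-shot delivery over multicast groups of `t + 1` users. Every broadcast takes place within
a group `G` of `t + 1` users that contains the sender, and is the XOR of one packet for each of the
`t` other users of `G`, demanded and not cached by that user and cached by all the others.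
Every packet that a user demands and has not cached is in a broadcast (by another user) whose
further packets that user has cached. -/
def IsOneShotMulticast (t : ℕ) : Prop :=
  ∀ d : Fin K → Fin N,
    (∀ τ ∈ S.delivery d, ∃ (G : Finset (Fin K)) (p : Fin K → Fin F),
      G.card = t + 1 ∧ τ.sender ∈ G ∧
      τ.packets = (G.erase τ.sender).image (fun u => (d u, p u)) ∧
      ∀ u ∈ G.erase τ.sender, (d u, p u) ∉ S.cache u ∧
        ∀ v ∈ G.erase τ.sender, v ≠ u → (d v, p v) ∈ S.cache u) ∧
    (∀ (k : Fin K) (p : Fin F), (d k, p) ∉ S.cache k →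
      ∃ τ ∈ S.delivery d, τ.sender ≠ k ∧ (d k, p) ∈ τ.packets ∧
        ∀ x ∈ τ.packets, x ≠ (d k, p) → x ∈ S.cache k)

/-- Every user stores exactly `M * L` bits. -/
def HasMemory (M : ℝ) : Prop :=
  ∀ k : Fin K, ((∑ x ∈ S.cache k, S.len x.2 : ℕ) : ℝ) = M * L

/-- The number of bits broadcast for the demands `d`. -/
def load (d : Fin K → Fin N) : ℕ :=
  ((S.delivery d).map (fun τ => τ.size)).sum

/-- `R` is the communication rate: the number of broadcast bits, in units of the file size, for
the worst demands. -/
def HasRate (R : ℝ) : Prop :=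
  IsGreatest (Set.range fun d : Fin K → Fin N => (S.load d : ℝ) / L) R

end D2DScheme

/-- Packets per subfile of the `k`-th type, `1 ≤ k ≤ 2 * r + 1`. -/
def alphaPT (r k : ℕ) : ℕ := if k ≤ r then 2 * (k - 1) else 2 * r

/-- Number of subfiles of the `k`-th type, `1 ≤ k ≤ 2 * r + 1`. -/
def fPT (q r k : ℕ) : ℕ := (q + 1).choose (k - 1) * q.choose (2 * r + 1 - k)

/-- The subpacketization level of the scheme for `2 * q + 1` users and `t = 2 * r`. -/
def FPT (q r : ℕ) : ℕ := ∑ k ∈ Finset.Icc 1 (2 * r + 1), alphaPT r k * fPT q r k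

/-- The subpacketization level of the Ji–Caire–Molisch scheme. -/
def FJCM (K t : ℕ) : ℕ := t * K.choose t

/-!
Split the users into a class `A` of `q + 1` users and its complement of `q` users, and let every
file consist of one subfile for each set `T` of `2 * r` users, cached by the users of `T`. In the
Ji–Caire–Molisch scheme every user of a group of `2 * r + 1` users sends one message. Here, in a
group with at most `r` users in `A`, only these users send, two messages each. Then a subfile whose
home `T` has `j ≤ r` users in `A` needs only `2 * j` packets instead of `2 * r`, which gives the
subpacketization level `FPT q r`. Packets come in two sizes, labelled `true` and `false`: in a group
with more than `r` users in `A` the size of a message tells whether its sender is in `A`; otherwise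
each sender sends one message of either size. A subfile with `j = r` can be met in groups of both
kinds, but in both cases it is delivered in `r` packets of either size, so one splitting serves all
groups (`TwoClass.exists_bijOn_slots`, `TwoClass.exists_design`).

With equal sizes the users of `A` would have to store more than the others. All users store the same
amount if the subfile size, which is `j * x true + min j (2 * r - j) * x false`, is uncorrelated
with `j` under the hypergeometric distribution (`TwoClass.card_mul_sum_mem_eq`). Since `j` has
positive variance and `min j (2 * r - j)` is negatively correlated with `j`
(`sum_hypergeom_mul_abs_mul_deviation_pos`), positive integers `x true` and `x false` with this
property exist (`exists_packet_sizes`). The rate then follows by counting: every message serves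
exactly `2 * r` users, and every missing packet is delivered exactly once
(`MulticastDesign.mul_sum_size`).

For the limit, the hypergeometric distribution converges to the binomial one
(`tendsto_hypergeom_div`), whose mean absolute deviation telescopes (`sum_choose_mul_min`); the order
of the central binomial coefficient follows from its recursion by induction.
-/

/-! ### Decoding -/

namespace D2DScheme

/-- Decoding is possible as soon as every missing demanded packet occurs in a broadcast whose other
packets are cached: that broadcast and the cache determine the packet. -/
theorem isCorrect_of_forall_exists {N K L F : ℕ} (S : D2DScheme N K L F)
    (h : ∀ (d : Fin K → Fin N) (k : Fin K) (p : Fin F), (d k, p) ∉ S.cache k →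
      ∃ τ ∈ S.delivery d, (d k, p) ∈ τ.packets ∧
        ∀ x ∈ τ.packets, x ≠ (d k, p) → x ∈ S.cache k) :
    S.IsCorrect := by
  intro d k
  have key : ∀ W W' : Fin N → Fin L → ZMod 2, S.cacheContent W k = S.cacheContent W' k →
      S.received W d = S.received W' d → W (d k) = W' (d k) := by
    intro W W' hc hr
    have bit_eq : ∀ x ∈ S.cache k, ∀ i, S.packetBit W x i = S.packetBit W' x i := by
      intro x hx i
      by_cases hi : i < S.len x.2
      · exact congrFun (congrFun hc ⟨x, hx⟩) ⟨i, hi⟩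
      · simp [packetBit, hi]
    funext l
    obtain ⟨⟨p, i⟩, rfl⟩ := S.split.surjective l
    have hW : ∀ V : Fin N → Fin L → ZMod 2,
        V (d k) (S.split ⟨p, i⟩) = S.packetBit V (d k, p) i := by
      intro V
      simp [packetBit]
    rw [hW W, hW W']
    by_cases hp : (d k, p) ∈ S.cache k
    · exact bit_eq _ hp _
    obtain ⟨τ, hτ, hmem, hrest⟩ := h d k p hp
    obtain ⟨j, rfl⟩ := List.get_of_mem hτ
    have hi : (i : ℕ) < ((S.delivery d).get j).size := by
      rw [← ((S.delivery d).get j).size_eq _ hmem]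
      exact i.2
    have hsum := congrFun (congrFun hr j) ⟨i, hi⟩
    simp only [received, message] at hsum
    rw [← Finset.add_sum_erase _ _ hmem, ← Finset.add_sum_erase _ _ hmem,
      Finset.sum_congr rfl fun x hx => bit_eq x
        (hrest x (Finset.mem_of_mem_erase hx) (Finset.ne_of_mem_erase hx)) i] at hsum
    exact add_right_cancel hsum
  have hf : Function.FactorsThrough (fun W : Fin N → Fin L → ZMod 2 => W (d k))
      (fun W => (S.cacheContent W k, S.received W d)) := fun W W' hWW' =>
    key W W' (congrArg Prod.fst hWW') (congrArg Prod.snd hWW')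
  exact ⟨fun c m => Function.extend (fun W => (S.cacheContent W k, S.received W d))
    (fun W => W (d k)) (fun _ _ => 0) (c, m), fun W => hf.extend_apply _ W⟩

end D2DScheme

/-! ### Multicast designs -/

/-- The demand-independent pattern of a one-shot scheme. A packet `i : ι` of a file is cached by the
users in `home i`. A broadcast `m : β` is sent by `sender m` within the group `group m` and contains,
for each other user `u` of the group, the packet `packet m u` of the file that `u` demands;
the value of `packet m u` is irrelevant for the remaining users. Every packet is delivered exactly
once to each user outside its home. -/
structure MulticastDesign (U ι β : Type*) [DecidableEq U] (t : ℕ) where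
  home : ι → Finset U
  len : ι → ℕ
  group : β → Finset U
  sender : β → U
  size : β → ℕ
  packet : β → U → ι
  len_pos : ∀ i, 0 < len i
  card_home : ∀ i, (home i).card = t
  card_group : ∀ m, (group m).card = t + 1
  sender_mem : ∀ m, sender m ∈ group m
  home_packet : ∀ m, ∀ u ∈ (group m).erase (sender m), home (packet m u) = (group m).erase u
  len_packet : ∀ m, ∀ u ∈ (group m).erase (sender m), len (packet m u) = size m
  existsUnique_packet : ∀ i u, u ∉ home i →
    ∃! m, u ∈ (group m).erase (sender m) ∧ packet m u = i

namespace MulticastDesign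

variable {U ι β : Type*} [DecidableEq U] {t : ℕ}

/-- Double counting of the pairs of a broadcast and a user served by it: each broadcast serves `t`
users, and each packet is delivered once to each of the users that miss it. -/
theorem mul_sum_size [Fintype U] [Fintype ι] [Fintype β] (D : MulticastDesign U ι β t) :
    t * ∑ m, D.size m = (Fintype.card U - t) * ∑ i, D.len i := by
  classical
  have h1 : t * ∑ m, D.size m =
      ∑ x ∈ Finset.univ.sigma fun m => (D.group m).erase (D.sender m), D.size x.1 := by
    rw [Finset.sum_sigma, Finset.mul_sum]
    refine Finset.sum_congr rfl fun m _ => ?_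
    simp [Finset.card_erase_of_mem (D.sender_mem m), D.card_group]
  have h2 : (Fintype.card U - t) * ∑ i, D.len i =
      ∑ x ∈ Finset.univ.sigma fun i => (D.home i)ᶜ, D.len x.1 := by
    rw [Finset.sum_sigma, Finset.mul_sum]
    refine Finset.sum_congr rfl fun i _ => ?_
    simp [Finset.card_compl, D.card_home]
  rw [h1, h2]
  refine Finset.sum_bij (fun x _ => ⟨D.packet x.1 x.2, x.2⟩) ?_ ?_ ?_ ?_
  · rintro ⟨m, u⟩ hx
    have hu := (Finset.mem_sigma.1 hx).2
    simp [D.home_packet m u hu]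
  · rintro ⟨m, u⟩ hx ⟨m', u'⟩ hx' heq
    have hu := (Finset.mem_sigma.1 hx).2
    have hu' := (Finset.mem_sigma.1 hx').2
    simp only [Sigma.mk.injEq, heq_eq_eq] at heq
    obtain ⟨hp, rfl⟩ := heq
    obtain rfl : m = m' :=
      (D.existsUnique_packet (D.packet m u) u (by simp [D.home_packet m u hu])).unique
        ⟨hu, rfl⟩ ⟨hu', hp.symm⟩
    rfl
  · rintro ⟨i, u⟩ hx
    have hu := (Finset.mem_sigma.1 hx).2
    obtain ⟨m, ⟨hm, rfl⟩, -⟩ := D.existsUnique_packet i u (by simpa using hu)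
    exact ⟨⟨m, u⟩, by simpa using hm, rfl⟩
  · rintro ⟨m, u⟩ hx
    exact (D.len_packet m u (Finset.mem_sigma.1 hx).2).symm

variable {K : ℕ} [Fintype ι] [Fintype β] {N L F : ℕ}

/-- The scheme with `N` files given by a multicast design, for an enumeration `e` of its packets:
user `k` caches the packets of all files whose home contains `k`, and for any demands all the
broadcasts of the design are made. -/
noncomputable def toScheme (D : MulticastDesign (Fin K) ι β t) (e : Fin F ≃ ι)
    (hL : ∑ i, D.len i = L) : D2DScheme N K L F where
  len p := D.len (e p)
  len_pos p := D.len_pos _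
  split := Fintype.equivOfCardEq (by
    simp only [Fintype.card_sigma, Fintype.card_fin]
    rw [e.sum_comp D.len, hL])
  cache k := Finset.univ.filter fun x => k ∈ D.home (e x.2)
  delivery d := (Finset.univ : Finset β).toList.map fun m =>
    { sender := D.sender m
      packets := ((D.group m).erase (D.sender m)).image fun u => (d u, e.symm (D.packet m u))
      size := D.size m
      size_eq := by
        intro x hx
        obtain ⟨u, hu, rfl⟩ := Finset.mem_image.1 hx
        simp [D.len_packet m u hu] }
  sender_caches := by
    intro d τ hτ x hx
    obtain ⟨m, -, rfl⟩ := List.mem_map.1 hτ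
    obtain ⟨u, hu, rfl⟩ := Finset.mem_image.1 hx
    have := D.sender_mem m
    simp only [Finset.mem_filter, Finset.mem_univ, true_and, Equiv.apply_symm_apply]
    rw [D.home_packet m u hu]
    exact Finset.mem_erase.2 ⟨(Finset.ne_of_mem_erase hu).symm, this⟩

variable (D : MulticastDesign (Fin K) ι β t) (e : Fin F ≃ ι) (hL : ∑ i, D.len i = L)

theorem isOneShotMulticast_toScheme : (D.toScheme (N := N) e hL).IsOneShotMulticast t := by
  intro d
  refine ⟨fun τ hτ => ?_, fun k p hkp => ?_⟩
  · obtain ⟨m, -, rfl⟩ := List.mem_map.1 hτ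
    refine ⟨D.group m, fun u => e.symm (D.packet m u), D.card_group m, D.sender_mem m, rfl,
      fun u hu => ⟨?_, fun v hv hvu => ?_⟩⟩
    · simp [toScheme, D.home_packet m u hu]
    · simp only [toScheme, Finset.mem_filter, Finset.mem_univ, true_and, Equiv.apply_symm_apply]
      rw [D.home_packet m v hv]
      exact Finset.mem_erase.2 ⟨hvu.symm, Finset.mem_of_mem_erase hu⟩
  · have hk : k ∉ D.home (e p) := by simpa [toScheme] using hkp
    obtain ⟨m, ⟨hm, hp⟩, -⟩ := D.existsUnique_packet (e p) k hk
    refine ⟨_, List.mem_map.2 ⟨m, by simp, rfl⟩, (Finset.ne_of_mem_erase hm).symm,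
      Finset.mem_image.2 ⟨k, hm, by simp [hp]⟩, fun x hx hne => ?_⟩
    obtain ⟨v, hv, rfl⟩ := Finset.mem_image.1 hx
    have hvk : v ≠ k := by
      rintro rfl
      exact hne (by simp [hp])
    simp only [toScheme, Finset.mem_filter, Finset.mem_univ, true_and, Equiv.apply_symm_apply]
    rw [D.home_packet m v hv]
    exact Finset.mem_erase.2 ⟨hvk.symm, Finset.mem_of_mem_erase hm⟩

theorem isCorrect_toScheme : (D.toScheme (N := N) e hL).IsCorrect := by
  refine D2DScheme.isCorrect_of_forall_exists _ fun d k p hp => ?_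
  obtain ⟨τ, hτ, -, h⟩ := (D.isOneShotMulticast_toScheme (N := N) e hL d).2 k p hp
  exact ⟨τ, hτ, h⟩

theorem load_toScheme (d : Fin K → Fin N) :
    (D.toScheme (N := N) e hL).load d = ∑ m, D.size m := by
  simp [D2DScheme.load, toScheme, Function.comp_def]

theorem sum_cache_toScheme (k : Fin K) :
    ∑ x ∈ (D.toScheme (N := N) e hL).cache k, (D.toScheme (N := N) e hL).len x.2 =
      N * ∑ i with k ∈ D.home i, D.len i := by
  simp only [toScheme]
  rw [Finset.sum_filter, Fintype.sum_prod_type]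
  simp only
  rw [Finset.sum_const, Finset.card_univ, Fintype.card_fin, smul_eq_mul, Finset.sum_filter,
    e.sum_comp fun i => if k ∈ D.home i then D.len i else 0]

/-- A design in which every user caches the proportion `t / K` of each file gives schemes of the rate
`N / M - 1`. -/
theorem exists_scheme (hF : Fintype.card ι = F) (hL : ∑ i, D.len i = L) (hL0 : 0 < L)
    (hK : 0 < K) (ht : 0 < t) (htK : t ≤ K)
    (hbal : ∀ k, K * ∑ i with k ∈ D.home i, D.len i = t * L) {M : ℝ} (hN : 0 < N)
    (hM : (K : ℝ) * M / N = t) :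
    ∃ S : D2DScheme N K L F, S.HasMemory M ∧ S.IsCorrect ∧ S.IsOneShotMulticast t ∧
      S.HasRate ((N : ℝ) / M - 1) := by
  have e : Fin F ≃ ι := Fintype.equivOfCardEq (by simp [hF])
  have hN' : (0 : ℝ) < N := by exact_mod_cast hN
  have hK' : (0 : ℝ) < K := by exact_mod_cast hK
  have hL' : (0 : ℝ) < L := by exact_mod_cast hL0
  have ht' : (0 : ℝ) < t := by exact_mod_cast ht
  have hKM : (K : ℝ) * M = t * N := by rwa [div_eq_iff hN'.ne'] at hM
  have hMpos : 0 < M := by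
    by_contra hneg
    have := mul_nonpos_of_nonneg_of_nonpos hK'.le (not_lt.1 hneg)
    have := mul_pos ht' hN'
    linarith
  refine ⟨D.toScheme e hL, fun k => ?_, D.isCorrect_toScheme e hL,
    D.isOneShotMulticast_toScheme e hL, ?_⟩
  · rw [sum_cache_toScheme]
    have h : (K : ℝ) * ((∑ i with k ∈ D.home i, D.len i : ℕ) : ℝ) = t * L := by
      exact_mod_cast hbal k
    apply mul_left_cancel₀ hK'.ne'
    rw [Nat.cast_mul, ← mul_assoc (K : ℝ) M, hKM]
    linear_combination (N : ℝ) * h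
  · have hrate : ∀ d : Fin K → Fin N,
        ((D.toScheme (N := N) e hL).load d : ℝ) / L = (N : ℝ) / M - 1 := by
      intro d
      have h := D.mul_sum_size
      rw [hL, Fintype.card_fin] at h
      have h' : (t : ℝ) * ((∑ m, D.size m : ℕ) : ℝ) = (K - t) * L := by
        rw [← Nat.cast_sub htK]
        exact_mod_cast h
      rw [load_toScheme, div_eq_iff hL'.ne']
      apply mul_left_cancel₀ ht'.ne'
      rw [h']
      field_simp
      linear_combination hKM
    have : Nonempty (Fin N) := ⟨⟨0, hN⟩⟩
    unfold D2DScheme.HasRate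
    rw [funext hrate, Set.range_const]
    exact isGreatest_singleton

end MulticastDesign

/-! ### The design with two classes of users -/

namespace TwoClass

variable {U : Type*} [Fintype U] [DecidableEq U]

/-- The labels of the broadcasts of a group with `a` users in the class `A`, the senders being
restricted to `T`. If `a ≤ r`, each user of `A` sends one message with label `true` and one with
label `false`. If `a > r`, each user sends one message, with label `true` for the users of `A` and
`false` for the others. -/
def slots (A : Finset U) (r a : ℕ) (T : Finset U) : Finset (U × Bool) :=
  Finset.univ.filter fun s => s.1 ∈ T ∧ if a ≤ r then s.1 ∈ A else s.2 = decide (s.1 ∈ A)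

/-- The number of bits of a subfile whose home has `j` of its `2 * r` users in the class `A`, when
the packets with label `b` have `x b` bits. -/
def subfileSize (r : ℕ) (x : Bool → ℕ) (j : ℕ) : ℕ :=
  if j ≤ r then j * (x true + x false) else j * x true + (2 * r - j) * x false

/-- The packets of a file: a packet is a set `T` of `2 * r` users, which cache it, with one of the
labels that a group with as many users in `A` as `T` would use. -/
abbrev Packet (A : Finset U) (r : ℕ) : Type _ :=
  {i : Finset U × U × Bool // i.1.card = 2 * r ∧ i.2 ∈ slots A r (i.1 ∩ A).card i.1}

/-- The broadcasts: a group of `2 * r + 1` users with one of its labels. -/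
abbrev Broadcast (A : Finset U) (r : ℕ) : Type _ :=
  {m : Finset U × U × Bool // m.1.card = 2 * r + 1 ∧ m.2 ∈ slots A r (m.1 ∩ A).card m.1}

theorem sum_slots (A T : Finset U) (r a : ℕ) (g : Bool → ℕ) :
    ∑ s ∈ slots A r a T, g s.2 =
      if a ≤ r then (T ∩ A).card * (g true + g false)
      else (T ∩ A).card * g true + (T \ A).card * g false := by
  unfold slots
  have hI : (Finset.univ.filter fun v => v ∈ T ∧ v ∈ A) = T ∩ A := by ext; simp
  have hD : (Finset.univ.filter fun v => v ∈ T ∧ v ∉ A) = T \ A := by ext; simp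
  rw [Finset.sum_filter, Fintype.sum_prod_type]
  simp only [Fintype.sum_bool]
  rw [Finset.sum_add_distrib, ← Finset.sum_filter, ← Finset.sum_filter, Finset.sum_const,
    Finset.sum_const, smul_eq_mul, smul_eq_mul]
  split_ifs with h
  · rw [hI]; ring
  · simp only [eq_comm (a := true), eq_comm (a := false), decide_eq_true_eq, decide_eq_false_iff_not]
    rw [hI, hD]

theorem sum_slots_self (A T : Finset U) (r : ℕ) (hT : T.card = 2 * r) (x : Bool → ℕ) :
    ∑ s ∈ slots A r (T ∩ A).card T, x s.2 = subfileSize r x (T ∩ A).card := by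
  have h := Finset.card_inter_add_card_sdiff T A
  rw [sum_slots, subfileSize, show (T \ A).card = 2 * r - (T ∩ A).card by omega]

/-- The labels that reach a user `u ∉ T` within the group `insert u T` match the packets with home
`T`. The two sets are equal unless `T` has `r` users in `A` and `u ∈ A`; in that case both contain
`r` labels of either kind. -/
theorem exists_bijOn_slots (A T : Finset U) (r : ℕ) (u : U) (hT : T.card = 2 * r) (hu : u ∉ T) :
    ∃ ψ : U × Bool → U × Bool,
      Set.BijOn ψ (slots A r (insert u T ∩ A).card T) (slots A r (T ∩ A).card T) ∧
        ∀ s, s ∈ slots A r (insert u T ∩ A).card T → (ψ s).2 = s.2 := by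
  have hsum : ∀ g : Bool → ℕ, ∑ s ∈ slots A r (insert u T ∩ A).card T, g s.2 =
      ∑ s ∈ slots A r (T ∩ A).card T, g s.2 := by
    intro g
    have h := Finset.card_inter_add_card_sdiff T A
    have hcard : (insert u T ∩ A).card = (T ∩ A).card ∨
        (insert u T ∩ A).card = (T ∩ A).card + 1 := by
      by_cases huA : u ∈ A
      · right
        rw [Finset.insert_inter_of_mem huA, Finset.card_insert_of_notMem (by simp [hu])]
      · left
        rw [Finset.insert_inter_of_notMem huA]
    rw [sum_slots, sum_slots]
    by_cases h1 : (T ∩ A).card ≤ r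
    · by_cases h2 : (insert u T ∩ A).card ≤ r
      · rw [if_pos h1, if_pos h2]
      · rw [if_pos h1, if_neg h2, show (T \ A).card = (T ∩ A).card by omega]
        ring
    · rw [if_neg h1, if_neg (by omega)]
  have : Nonempty (U × Bool) := ⟨(u, true)⟩
  have hfib : ∀ b : Bool, ∃ φ : U × Bool → U × Bool,
      Set.BijOn φ {s | s ∈ slots A r (insert u T ∩ A).card T ∧ s.2 = b}
        {s | s ∈ slots A r (T ∩ A).card T ∧ s.2 = b} := by
    intro b
    refine (Set.toFinite _).exists_bijOn_of_encard_eq ?_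
    have h := hsum fun c => if c = b then 1 else 0
    rw [← Finset.card_filter, ← Finset.card_filter] at h
    rw [← Finset.coe_filter, ← Finset.coe_filter, Set.encard_coe_eq_coe_finsetCard,
      Set.encard_coe_eq_coe_finsetCard, h]
  choose φ hφ using hfib
  refine ⟨fun s => φ s.2 s, ⟨fun s hs => ((hφ s.2).mapsTo ⟨hs, rfl⟩).1, ?_, ?_⟩,
    fun s hs => ((hφ s.2).mapsTo ⟨hs, rfl⟩).2⟩
  · intro s hs s' hs' heq
    have h1 := ((hφ s.2).mapsTo ⟨hs, rfl⟩).2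
    have h2 := ((hφ s'.2).mapsTo ⟨hs', rfl⟩).2
    have h3 : s.2 = s'.2 := by
      rw [← h1, ← h2]
      exact congrArg Prod.snd heq
    refine (hφ s.2).injOn ⟨hs, rfl⟩ ⟨hs', h3.symm⟩ ?_
    simpa only [← h3] using heq
  · intro s hs
    obtain ⟨s', ⟨hs', h2⟩, heq⟩ := (hφ s.2).surjOn ⟨hs, rfl⟩
    exact ⟨s', hs', by simpa only [h2] using heq⟩

theorem mem_slots_erase {A G : Finset U} {r a : ℕ} {u : U} {s : U × Bool} :
    s ∈ slots A r a (G.erase u) ↔ s ∈ slots A r a G ∧ s.1 ≠ u := by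
  simp only [slots, Finset.mem_filter, Finset.mem_univ, true_and, Finset.mem_erase]
  tauto

theorem exists_design (A : Finset U) (r : ℕ) (x : Bool → ℕ) (hx : ∀ b, 0 < x b)
    (hne : Nonempty (Packet A r)) :
    ∃ D : MulticastDesign U (Packet A r) (Broadcast A r) (2 * r),
      (∀ i, D.home i = i.1.1) ∧ ∀ i, D.len i = x i.1.2.2 := by
  choose! ψ hψ hψ2 using fun (T : Finset U) (u : U) (h : T.card = 2 * r ∧ u ∉ T) =>
    exists_bijOn_slots A T r u h.1 h.2
  have serves : ∀ (m : Broadcast A r) (u : U), u ∈ m.1.1.erase m.1.2.1 →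
      (m.1.1.erase u).card = 2 * r ∧ u ∉ m.1.1.erase u ∧
        m.1.2 ∈ slots A r (insert u (m.1.1.erase u) ∩ A).card (m.1.1.erase u) := by
    intro m u hu
    have huG := Finset.mem_of_mem_erase hu
    refine ⟨?_, Finset.notMem_erase _ _, ?_⟩
    · rw [Finset.card_erase_of_mem huG, m.2.1]
      rfl
    · rw [Finset.insert_erase huG, mem_slots_erase]
      exact ⟨m.2.2, (Finset.ne_of_mem_erase hu).symm⟩
  have valid : ∀ (m : Broadcast A r) (u : U), u ∈ m.1.1.erase m.1.2.1 →
      (m.1.1.erase u).card = 2 * r ∧ ψ (m.1.1.erase u) u m.1.2 ∈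
        slots A r (m.1.1.erase u ∩ A).card (m.1.1.erase u) := by
    intro m u hu
    obtain ⟨h1, h2, h3⟩ := serves m u hu
    exact ⟨h1, (hψ _ u ⟨h1, h2⟩).mapsTo h3⟩
  classical
  let packet : Broadcast A r → U → Packet A r := fun m u =>
    if h : u ∈ m.1.1.erase m.1.2.1 then
      ⟨(m.1.1.erase u, ψ (m.1.1.erase u) u m.1.2), valid m u h⟩
    else hne.some
  have packet_val : ∀ m u, u ∈ m.1.1.erase m.1.2.1 →
      (packet m u).1 = (m.1.1.erase u, ψ (m.1.1.erase u) u m.1.2) := by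
    intro m u h
    simp only [packet]
    rw [dif_pos h]
  refine ⟨{
    home := fun i => i.1.1
    len := fun i => x i.1.2.2
    group := fun m => m.1.1
    sender := fun m => m.1.2.1
    size := fun m => x m.1.2.2
    packet := packet
    len_pos := fun i => hx _
    card_home := fun i => i.2.1
    card_group := fun m => m.2.1
    sender_mem := fun m => (Finset.mem_filter.1 m.2.2).2.1
    home_packet := fun m u hu => by rw [packet_val m u hu]
    len_packet := fun m u hu => by
      obtain ⟨h1, h2, h3⟩ := serves m u hu
      rw [packet_val m u hu]
      exact congrArg x (hψ2 _ u ⟨h1, h2⟩ _ h3)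
    existsUnique_packet := ?_ }, fun i => rfl, fun i => rfl⟩
  rintro ⟨⟨T, s⟩, hT, hs⟩ u hu
  change T.card = 2 * r at hT
  change s ∈ slots A r (T ∩ A).card T at hs
  change u ∉ T at hu
  have hbij := hψ T u ⟨hT, hu⟩
  obtain ⟨s', hs', rfl⟩ := hbij.surjOn hs
  rw [Finset.mem_coe] at hs'
  have hs'' : s' ∈ slots A r (insert u T ∩ A).card (insert u T) ∧ s'.1 ≠ u := by
    rwa [← mem_slots_erase, Finset.erase_insert hu]
  refine ⟨⟨(insert u T, s'), by simp [Finset.card_insert_of_notMem hu, hT], hs''.1⟩, ?_, ?_⟩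
  · have hmem : u ∈ (insert u T).erase s'.1 :=
      Finset.mem_erase.2 ⟨hs''.2.symm, Finset.mem_insert_self _ _⟩
    refine ⟨hmem, Subtype.ext ?_⟩
    rw [packet_val _ _ hmem]
    simp only [Finset.erase_insert hu]
  · rintro ⟨⟨G, s₂⟩, hG, hs₂⟩ ⟨hmem, heq⟩
    change u ∈ G.erase s₂.1 at hmem
    have h := congrArg Subtype.val heq
    rw [packet_val _ _ hmem] at h
    simp only [Prod.mk.injEq] at h
    obtain ⟨rfl, h⟩ := h
    have huG := Finset.mem_of_mem_erase hmem
    have h₂ := (serves ⟨(G, s₂), hG, hs₂⟩ u hmem).2.2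
    obtain rfl : s₂ = s' := hbij.injOn h₂ hs' h
    refine Subtype.ext ?_
    simp [Finset.insert_erase huG]

theorem sum_packet (A : Finset U) (r : ℕ) (h : Finset U → Bool → ℕ) :
    ∑ i : Packet A r, h i.1.1 i.1.2.2 =
      ∑ T ∈ Finset.powersetCard (2 * r) Finset.univ,
        ∑ s ∈ slots A r (T ∩ A).card T, h T s.2 := by
  rw [← Finset.sum_subtype (Finset.univ.filter fun i : Finset U × U × Bool =>
    i.1.card = 2 * r ∧ i.2 ∈ slots A r (i.1 ∩ A).card i.1) (by simp) fun i => h i.1 i.2.2]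
  exact Finset.sum_finset_product _ _ (fun T => slots A r (T ∩ A).card T) (by simp)

/-! ### Counting sets of users by their number of users of a class -/

theorem card_filter_card_inter (A : Finset U) (t j : ℕ) (hj : j ≤ t) :
    ((Finset.powersetCard t Finset.univ).filter fun T => (T ∩ A).card = j).card =
      A.card.choose j * (Aᶜ).card.choose (t - j) := by
  rw [← Finset.card_powersetCard, ← Finset.card_powersetCard, ← Finset.card_product]
  refine Finset.card_nbij' (fun T => (T ∩ A, T \ A)) (fun X => X.1 ∪ X.2) ?_ ?_ ?_ ?_
  · intro T hT
    simp only [Finset.coe_filter, Finset.mem_powersetCard_univ, Set.mem_ofPred_eq] at hT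
    have h := Finset.card_inter_add_card_sdiff T A
    simp only [Finset.coe_product, Set.mem_prod, Finset.mem_coe, Finset.mem_powersetCard]
    refine ⟨⟨Finset.inter_subset_right, hT.2⟩, fun v hv => ?_, by omega⟩
    simp only [Finset.mem_sdiff] at hv
    simpa using hv.2
  · rintro ⟨X, Y⟩ h
    simp only [Finset.coe_product, Set.mem_prod, Finset.mem_coe, Finset.mem_powersetCard] at h
    obtain ⟨⟨hX, hXj⟩, hY, hYj⟩ := h
    have hd : Disjoint Y A := Finset.disjoint_left.2 fun v hv => by simpa using hY hv
    have hXA : (X ∪ Y) ∩ A = X := by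
      rw [Finset.union_inter_distrib_right, Finset.inter_eq_left.2 hX,
        Finset.disjoint_iff_inter_eq_empty.1 hd, Finset.union_empty]
    simp only [Finset.coe_filter, Finset.mem_powersetCard_univ, Set.mem_ofPred_eq, hXA]
    rw [Finset.card_union_of_disjoint (hd.symm.mono_left hX)]
    exact ⟨by omega, hXj⟩
  · intro T _
    exact (Finset.union_comm _ _).trans (Finset.sdiff_union_inter T A)
  · rintro ⟨X, Y⟩ h
    simp only [Finset.coe_product, Set.mem_prod, Finset.mem_coe, Finset.mem_powersetCard] at h
    obtain ⟨⟨hX, -⟩, hY, -⟩ := h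
    have hY' : ∀ v ∈ Y, v ∉ A := fun v hv => by simpa using hY hv
    refine Prod.ext ?_ ?_
    · ext v
      simp only [Finset.mem_inter, Finset.mem_union]
      exact ⟨fun h => h.1.resolve_right fun hv => hY' v hv h.2, fun h => ⟨.inl h, hX h⟩⟩
    · ext v
      simp only [Finset.mem_sdiff, Finset.mem_union]
      exact ⟨fun h => h.1.resolve_left fun hv => h.2 (hX hv), fun h => ⟨.inr h, hY' v h⟩⟩

theorem sum_powersetCard_card_inter {R : Type*} [CommSemiring R] (A : Finset U) (t : ℕ)
    (f : ℕ → R) :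
    ∑ T ∈ Finset.powersetCard t Finset.univ, f (T ∩ A).card =
      ∑ j ∈ Finset.range (t + 1), ((A.card.choose j * (Aᶜ).card.choose (t - j) : ℕ) : R) * f j := by
  rw [← Finset.sum_fiberwise_of_maps_to (t := Finset.range (t + 1))
    (g := fun T : Finset U => (T ∩ A).card)]
  · refine Finset.sum_congr rfl fun j hj => ?_
    rw [← card_filter_card_inter A t j (by simpa [Nat.lt_succ_iff] using hj), ← nsmul_eq_mul,
      ← Finset.sum_const]
    exact Finset.sum_congr rfl fun T hT => by rw [(Finset.mem_filter.1 hT).2]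
  · intro T hT
    have := Finset.card_le_card (Finset.inter_subset_left (s₁ := T) (s₂ := A))
    have := (Finset.mem_powersetCard.1 hT).2
    simp only [Finset.mem_range]
    omega

/-- Exchanging two users of the same class shows that they are in sets of equal total weight. -/
theorem sum_mem_congr (A : Finset U) (t : ℕ) (f : ℕ → ℤ) {u v : U} (huv : u ∈ A ↔ v ∈ A) :
    ∑ T ∈ Finset.powersetCard t Finset.univ with u ∈ T, f (T ∩ A).card =
      ∑ T ∈ Finset.powersetCard t Finset.univ with v ∈ T, f (T ∩ A).card := by
  have hA : A.map (Equiv.swap u v).toEmbedding = A := by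
    ext w
    rw [Finset.mem_map_equiv, Equiv.symm_swap, Equiv.swap_apply_def]
    split_ifs with h1 h2
    · rw [h1, huv]
    · rw [h2, huv]
    · rfl
  refine Finset.sum_equiv (Equiv.swap u v).finsetCongr (fun T => ?_) fun T _ => ?_
  · simp [Finset.mem_map_equiv]
  · rw [Equiv.finsetCongr_apply]
    nth_rewrite 2 [← hA]
    rw [← Finset.map_inter, Finset.card_map]

theorem card_mul_sum_mem (A B : Finset U) (t : ℕ) (f : ℕ → ℤ) (hB : B = A ∨ B = Aᶜ) {u : U}
    (hu : u ∈ B) :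
    B.card * ∑ T ∈ Finset.powersetCard t Finset.univ with u ∈ T, f (T ∩ A).card =
      ∑ T ∈ Finset.powersetCard t Finset.univ, (T ∩ B).card * f (T ∩ A).card := by
  have h1 : ∀ v ∈ B, ∑ T ∈ Finset.powersetCard t Finset.univ with v ∈ T, f (T ∩ A).card =
      ∑ T ∈ Finset.powersetCard t Finset.univ with u ∈ T, f (T ∩ A).card := by
    intro v hv
    apply sum_mem_congr
    rcases hB with rfl | rfl
    · simp [hu, hv]
    · simp only [Finset.mem_compl] at hu hv
      simp [hu, hv]
  rw [← nsmul_eq_mul, ← Finset.sum_const, ← Finset.sum_congr rfl h1]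
  simp only [Finset.sum_filter]
  rw [Finset.sum_comm]
  refine Finset.sum_congr rfl fun T _ => ?_
  rw [← Finset.sum_filter, Finset.sum_const, nsmul_eq_mul, Finset.filter_mem_eq_inter,
    Finset.inter_comm B T]

/-- If the weight of a random `t`-set is uncorrelated with its number of users in `A`, then all
users are in sets of equal total weight. -/
theorem card_mul_sum_mem_eq (A : Finset U) (t : ℕ) (f : ℕ → ℤ)
    (hf : ∑ j ∈ Finset.range (t + 1), ((A.card.choose j * (Aᶜ).card.choose (t - j) : ℕ) : ℤ) *
      (f j * (j * Fintype.card U - t * A.card)) = 0) (u : U) :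
    Fintype.card U * ∑ T ∈ Finset.powersetCard t Finset.univ with u ∈ T, f (T ∩ A).card =
      t * ∑ T ∈ Finset.powersetCard t Finset.univ, f (T ∩ A).card := by
  rw [← sum_powersetCard_card_inter A t fun j : ℕ =>
    f j * ((j : ℤ) * Fintype.card U - t * A.card)] at hf
  have hcompl : ((Aᶜ).card : ℤ) = Fintype.card U - A.card := by
    rw [Finset.card_compl, Nat.cast_sub (Finset.card_le_univ A)]
  by_cases hu : u ∈ A
  · have hA : (A.card : ℤ) ≠ 0 := by exact_mod_cast (Finset.card_pos.2 ⟨u, hu⟩).ne'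
    have h := card_mul_sum_mem A A t f (.inl rfl) hu
    apply mul_left_cancel₀ hA
    rw [mul_left_comm, h, Finset.mul_sum, Finset.mul_sum, Finset.mul_sum, ← sub_eq_zero,
      ← Finset.sum_sub_distrib, ← hf]
    exact Finset.sum_congr rfl fun T _ => by ring
  · have hu' : u ∈ Aᶜ := Finset.mem_compl.2 hu
    have hA : ((Aᶜ).card : ℤ) ≠ 0 := by exact_mod_cast (Finset.card_pos.2 ⟨u, hu'⟩).ne'
    have h := card_mul_sum_mem A Aᶜ t f (.inr rfl) hu'
    apply mul_left_cancel₀ hA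
    rw [mul_left_comm, h, Finset.mul_sum, Finset.mul_sum, Finset.mul_sum, ← sub_eq_zero,
      ← Finset.sum_sub_distrib, ← neg_eq_zero, ← hf, ← Finset.sum_neg_distrib]
    refine Finset.sum_congr rfl fun T hT => ?_
    have h2 := Finset.card_inter_add_card_sdiff T A
    rw [(Finset.mem_powersetCard.1 hT).2, Finset.sdiff_eq_inter_compl] at h2
    have h3 : ((T ∩ Aᶜ).card : ℤ) = t - (T ∩ A).card := by
      rw [← h2]
      push_cast
      ring
    rw [h3, hcompl]
    ring

end TwoClass

/-! ### The two packet sizes -/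

/-- The number of sets of `2 * r` users among `2 * q + 1` with `j` users in a class of `q + 1`. -/
def hypergeom (q r j : ℕ) : ℕ := (q + 1).choose j * q.choose (2 * r - j)

/-- `2 * q + 1` times the deviation of `j` from the mean `2 * r * (q + 1) / (2 * q + 1)` of the
distribution given by `hypergeom q r`. -/
def deviation (q r : ℕ) (j : ℕ) : ℤ := j * (2 * q + 1) - 2 * r * (q + 1)

/-- This makes the sum of the deviations telescope, see `sum_hypergeom_mul_deviation`. -/
theorem hypergeom_mul_deviation {q r j : ℕ} (hj : j < 2 * r) :
    (hypergeom q r j : ℤ) * deviation q r j =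
      j * (q + j - 2 * r) * hypergeom q r j -
        (j + 1) * (q + (j + 1) - 2 * r) * hypergeom q r (j + 1) := by
  obtain ⟨s, hs⟩ : ∃ s, 2 * r = j + 1 + s := ⟨2 * r - (j + 1), by omega⟩
  have h2r : (2 * r : ℤ) = j + 1 + s := by exact_mod_cast hs
  have choose_succ : ∀ n k : ℕ, (n.choose (k + 1) : ℤ) * (k + 1) = n.choose k * (n - k) := by
    intro n k
    rcases le_or_gt k n with h | h
    · rw [← Nat.cast_sub h]
      exact_mod_cast Nat.choose_succ_right_eq n k
    · simp [Nat.choose_eq_zero_of_lt h, Nat.choose_eq_zero_of_lt (h.trans (Nat.lt_succ_self k))]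
  have h1 := choose_succ (q + 1) j
  have h2 := choose_succ q s
  unfold hypergeom deviation
  rw [show 2 * r - j = s + 1 by omega, show 2 * r - (j + 1) = s by omega, h2r]
  push_cast at h1 h2 ⊢
  linear_combination (q.choose s : ℤ) * ((q : ℤ) - s) * h1 +
    (j - q - 1) * ((q + 1).choose j : ℤ) * h2

theorem sum_hypergeom_mul_deviation (q r : ℕ) :
    ∑ j ∈ Finset.range (2 * r + 1), (hypergeom q r j : ℤ) * deviation q r j = 0 := by
  have h : ∀ k ≤ 2 * r, ∑ j ∈ Finset.range k, (hypergeom q r j : ℤ) * deviation q r j =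
      -(k * (q + k - 2 * r) * hypergeom q r k) := by
    intro k
    induction k with
    | zero => simp
    | succ k ih =>
      intro hk
      rw [Finset.sum_range_succ, ih (by omega), hypergeom_mul_deviation (by omega)]
      push_cast
      ring
  rw [Finset.sum_range_succ, h _ le_rfl, deviation]
  push_cast
  ring

theorem hypergeom_pos {q r : ℕ} (hrq : r ≤ q) : 0 < hypergeom q r r :=
  Nat.mul_pos (Nat.choose_pos (by omega)) (Nat.choose_pos (by omega))

theorem sum_hypergeom_mul_mul_deviation_pos {q r : ℕ} (hr : 0 < r) (hrq : r ≤ q) :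
    0 < ∑ j ∈ Finset.range (2 * r + 1), (hypergeom q r j : ℤ) * (j * deviation q r j) := by
  have hK : (0 : ℤ) < 2 * q + 1 := by positivity
  refine pos_of_mul_pos_right (a := (2 * q + 1 : ℤ)) ?_ hK.le
  have h : (2 * q + 1 : ℤ) *
      ∑ j ∈ Finset.range (2 * r + 1), (hypergeom q r j : ℤ) * (j * deviation q r j) =
      ∑ j ∈ Finset.range (2 * r + 1), (hypergeom q r j : ℤ) * deviation q r j ^ 2 +
        2 * r * (q + 1) *
          ∑ j ∈ Finset.range (2 * r + 1), (hypergeom q r j : ℤ) * deviation q r j := by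
    rw [Finset.mul_sum, Finset.mul_sum, ← Finset.sum_add_distrib]
    refine Finset.sum_congr rfl fun j _ => ?_
    unfold deviation
    ring
  rw [h, sum_hypergeom_mul_deviation, mul_zero, add_zero]
  refine Finset.sum_pos' (fun j _ => by positivity) ⟨r, by simp; omega, ?_⟩
  have hc : (0 : ℤ) < hypergeom q r r := by exact_mod_cast hypergeom_pos hrq
  have hd : deviation q r r = -r := by
    unfold deviation
    ring
  rw [hd, neg_sq]
  positivity

/-- The reflection `j ↦ 2 * r - j` exchanges the two binomial coefficients of `hypergeom` up to a
linear factor. -/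
theorem hypergeom_reflect {q r j : ℕ} (hj : j ≤ 2 * r) :
    ((q + 1 - j : ℤ)) * hypergeom q r j =
      (q + 1 - (2 * r - j)) * hypergeom q r (2 * r - j) := by
  have h : ∀ k : ℕ, (q + 1 - k : ℤ) * (q + 1).choose k = (q + 1) * q.choose k := by
    intro k
    rcases le_or_gt k (q + 1) with hk | hk
    · have := Nat.choose_mul_succ_eq q k
      have h' : ((q + 1 - k : ℕ) : ℤ) = q + 1 - k := by push_cast [Nat.cast_sub hk]; ring
      rw [← h']
      have h2 : (q.choose k : ℤ) * (q + 1) = (q + 1).choose k * (q + 1 - k : ℕ) := by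
        exact_mod_cast this
      linear_combination -h2
    · simp [Nat.choose_eq_zero_of_lt hk, Nat.choose_eq_zero_of_lt (show q < k by omega)]
  have h1 := h j
  have h2 := h (2 * r - j)
  rw [Nat.cast_sub hj] at h2
  unfold hypergeom
  rw [show 2 * r - (2 * r - j) = j by omega]
  push_cast at h1 h2 ⊢
  linear_combination (q.choose (2 * r - j) : ℤ) * h1 - (q.choose j : ℤ) * h2

theorem hypergeom_mul_deviation_add_reflect {q r j : ℕ} (hj : j ≤ 2 * r) :
    (q + 1 - r : ℤ) * (hypergeom q r j * deviation q r j +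
        hypergeom q r (2 * r - j) * deviation q r (2 * r - j)) =
      (hypergeom q r j + hypergeom q r (2 * r - j)) *
        ((j - r) ^ 2 * (2 * q + 1) - r * (q + 1 - r)) := by
  have h := hypergeom_reflect (q := q) hj
  unfold deviation
  rw [Nat.cast_sub hj]
  push_cast
  linear_combination ((j : ℤ) - r) * (2 * q + 1) * h

/-- The distance of `j` to `r` is positively correlated with `j`. After adding the terms of `j` and
`2 * r - j`, the deviations sum to zero and are negative exactly when `|j - r|` is below a
threshold, so that weighting them by the increasing function `|j - r|` gives a positive sum. -/
theorem sum_hypergeom_mul_abs_mul_deviation_pos {q r : ℕ} (hr : 0 < r) (hrq : r ≤ q) :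
    0 < ∑ j ∈ Finset.range (2 * r + 1),
      (hypergeom q r j : ℤ) * (|(j : ℤ) - r| * deviation q r j) := by
  have hr' : (0 : ℝ) < r := by exact_mod_cast hr
  have hrq' : (r : ℝ) ≤ q := by exact_mod_cast hrq
  have hK : (0 : ℝ) < 2 * q + 1 := by positivity
  have hs : (0 : ℝ) < q + 1 - r := by linarith
  obtain ⟨y, hy, hy2⟩ : ∃ y : ℝ, 0 < y ∧ y ^ 2 * (2 * q + 1) = r * (q + 1 - r) :=
    ⟨√(r * (q + 1 - r) / (2 * q + 1)), by positivity, by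
      rw [Real.sq_sqrt (by positivity), div_mul_cancel₀ _ hK.ne']⟩
  let g : ℕ → ℝ := fun j => (hypergeom q r j : ℝ) * deviation q r j
  have hg0 : ∑ j ∈ Finset.range (2 * r + 1), g j = 0 := by
    simp only [g]
    exact_mod_cast sum_hypergeom_mul_deviation q r
  have hmain : 0 < ∑ j ∈ Finset.range (2 * r + 1), (g j + g (2 * r - j)) * (|(j : ℝ) - r| - y) := by
    have hterm : ∀ j ≤ 2 * r, (g j + g (2 * r - j)) * (|(j : ℝ) - r| - y) =
        (hypergeom q r j + hypergeom q r (2 * r - j)) / (q + 1 - r) * (2 * q + 1) *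
          ((|(j : ℝ) - r| - y) ^ 2 * (|(j : ℝ) - r| + y)) := by
      intro j hj
      have h : (q + 1 - r : ℝ) * (g j + g (2 * r - j)) =
          (hypergeom q r j + hypergeom q r (2 * r - j)) *
            ((j - r) ^ 2 * (2 * q + 1) - r * (q + 1 - r)) := by
        have h := congrArg (Int.cast : ℤ → ℝ) (hypergeom_mul_deviation_add_reflect (q := q) hj)
        push_cast at h
        exact h
      rw [← hy2, ← sq_abs ((j : ℝ) - r)] at h
      field_simp
      linear_combination (|(j : ℝ) - r| - y) * h
    refine Finset.sum_pos' (fun j hj => ?_) ⟨r, by simp; omega, ?_⟩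
    · rw [hterm j (by simpa [Nat.lt_succ_iff] using hj)]
      positivity
    · rw [hterm r (by omega)]
      have : (0 : ℝ) < hypergeom q r r := by exact_mod_cast hypergeom_pos hrq
      simp only [sub_self, abs_zero, zero_sub, zero_add, even_two, Even.neg_pow]
      positivity
  have hrefl : ∑ j ∈ Finset.range (2 * r + 1), g (2 * r - j) * (|(j : ℝ) - r| - y) =
      ∑ j ∈ Finset.range (2 * r + 1), g j * (|(j : ℝ) - r| - y) := by
    rw [← Finset.sum_range_reflect]
    refine Finset.sum_congr rfl fun j hj => ?_
    have hj' : j ≤ 2 * r := by simpa [Nat.lt_succ_iff] using hj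
    rw [show 2 * r + 1 - 1 - j = 2 * r - j by omega, show 2 * r - (2 * r - j) = j by omega,
      Nat.cast_sub hj', abs_sub_comm]
    push_cast
    ring_nf
  simp only [add_mul] at hmain
  rw [Finset.sum_add_distrib, hrefl] at hmain
  simp only [mul_sub] at hmain
  rw [Finset.sum_sub_distrib, ← Finset.sum_mul, hg0, zero_mul, sub_zero] at hmain
  have hsum : ((∑ j ∈ Finset.range (2 * r + 1),
      (hypergeom q r j : ℤ) * (|(j : ℤ) - r| * deviation q r j) : ℤ) : ℝ) =
      ∑ j ∈ Finset.range (2 * r + 1), g j * |(j : ℝ) - r| := by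
    push_cast
    exact Finset.sum_congr rfl fun j _ => by simp only [g]; ring
  have h : (0 : ℝ) < ((∑ j ∈ Finset.range (2 * r + 1),
      (hypergeom q r j : ℤ) * (|(j : ℤ) - r| * deviation q r j) : ℤ) : ℝ) := by
    rw [hsum]
    linarith
  exact_mod_cast h

theorem cast_subfileSize {r j : ℕ} (hj : j ≤ 2 * r) (x : Bool → ℕ) :
    (TwoClass.subfileSize r x j : ℤ) = j * x true + (r - |(j : ℤ) - r|) * x false := by
  unfold TwoClass.subfileSize
  split_ifs with h
  · rw [abs_of_nonpos (by omega)]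
    push_cast
    ring
  · rw [abs_of_nonneg (by omega), Nat.cast_add, Nat.cast_mul, Nat.cast_mul, Nat.cast_sub hj]
    push_cast
    ring

/-- There are positive packet sizes for which the size of a subfile is uncorrelated with the number
of users of the larger class in its home. -/
theorem exists_packet_sizes {q r : ℕ} (hr : 0 < r) (hrq : r ≤ q) :
    ∃ x : Bool → ℕ, (∀ b, 0 < x b) ∧ ∑ j ∈ Finset.range (2 * r + 1),
      (hypergeom q r j : ℤ) * (TwoClass.subfileSize r x j * deviation q r j) = 0 := by
  have hv := sum_hypergeom_mul_mul_deviation_pos hr hrq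
  have hc := sum_hypergeom_mul_abs_mul_deviation_pos hr hrq
  have h0 := sum_hypergeom_mul_deviation q r
  -- The subfile sizes are `j * x true + (r - |j - r|) * x false`, and the covariance of `j` with
  -- `r - |j - r|` is, up to scale, the negative of `C`.
  obtain ⟨V, hV⟩ := Int.eq_ofNat_of_zero_le hv.le
  obtain ⟨C, hC⟩ := Int.eq_ofNat_of_zero_le hc.le
  refine ⟨fun b => if b then C else V, fun b => ?_, ?_⟩
  · rw [hV] at hv
    rw [hC] at hc
    cases b
    · simpa using hv
    · simpa using hc
  · have h : ∀ j ∈ Finset.range (2 * r + 1),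
        (hypergeom q r j : ℤ) * (TwoClass.subfileSize r (fun b => if b then C else V) j *
          deviation q r j) =
        (hypergeom q r j : ℤ) * (j * deviation q r j) * C +
          ((hypergeom q r j : ℤ) * deviation q r j * (r * V) -
          (hypergeom q r j : ℤ) * (|(j : ℤ) - r| * deviation q r j) * V) := by
      intro j hj
      rw [cast_subfileSize (by simpa [Nat.lt_succ_iff] using hj)]
      simp only [if_true, Bool.false_eq_true, if_false]
      ring
    rw [Finset.sum_congr rfl h, Finset.sum_add_distrib, Finset.sum_sub_distrib, ← Finset.sum_mul,
      ← Finset.sum_mul, ← Finset.sum_mul, hV, hC, h0]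
    ring

/-! ### The subpacketization level and its asymptotics -/

theorem FPT_eq_sum (q r : ℕ) :
    FPT q r = ∑ j ∈ Finset.range (2 * r + 1), hypergeom q r j * min (2 * j) (2 * r) := by
  have h : Finset.Icc 1 (2 * r + 1) = Finset.Ico (0 + 1) (2 * r + 1 + 1) := by
    ext
    simp only [Finset.mem_Icc, Finset.mem_Ico]
    omega
  rw [FPT, h, ← Finset.sum_Ico_add' (fun k => alphaPT r k * fPT q r k), ← Finset.range_eq_Ico]
  refine Finset.sum_congr rfl fun j _ => ?_
  simp only [alphaPT, fPT, hypergeom, Nat.add_sub_cancel, Nat.add_sub_add_right]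
  rw [mul_comm]
  congr 1
  split_ifs <;> omega

theorem sum_hypergeom (q r : ℕ) :
    ∑ j ∈ Finset.range (2 * r + 1), hypergeom q r j = (2 * q + 1).choose (2 * r) := by
  rw [show 2 * q + 1 = (q + 1) + q by ring, Nat.add_choose_eq,
    Finset.Nat.sum_antidiagonal_eq_sum_range_succ_mk]
  rfl

theorem FPT_le_FJCM (q r : ℕ) : FPT q r ≤ FJCM (2 * q + 1) (2 * r) := by
  rw [FPT_eq_sum, FJCM, ← sum_hypergeom, Finset.mul_sum]
  refine Finset.sum_le_sum fun j _ => ?_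
  rw [mul_comm]
  exact Nat.mul_le_mul_right _ (min_le_right _ _)

theorem FPT_pos {q r : ℕ} (hr : 0 < r) (hrq : r ≤ q) : 0 < FPT q r := by
  rw [FPT_eq_sum]
  refine Finset.sum_pos' (fun _ _ => Nat.zero_le _) ⟨r, by simp; omega, ?_⟩
  rw [min_self]
  exact Nat.mul_pos (hypergeom_pos hrq) (by omega)

theorem tendsto_choose_div_pow {s : ℕ → ℕ} {c : ℝ} (hs : Tendsto s atTop atTop)
    (hc : Tendsto (fun q : ℕ => (s q : ℝ) / q) atTop (𝓝 c)) (k : ℕ) :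
    Tendsto (fun q : ℕ => ((s q).choose k : ℝ) / (q : ℝ) ^ k) atTop
      (𝓝 (c ^ k / k.factorial)) := by
  have h := ((isEquivalent_choose k).comp_tendsto hs).div
    (IsEquivalent.refl (u := fun q : ℕ => (q : ℝ) ^ k))
  refine h.symm.tendsto_nhds (((hc.pow k).div_const _).congr fun q => ?_)
  simp only [Function.comp, Pi.div_apply, div_pow]
  ring

/-- The hypergeometric distribution converges to the binomial distribution with parameter `1/2`. -/
theorem tendsto_hypergeom_div (r j : ℕ) (hj : j ≤ 2 * r) :
    Tendsto (fun q : ℕ => (hypergeom q r j : ℝ) / ((2 * q + 1).choose (2 * r) : ℝ)) atTop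
      (𝓝 (((2 * r).choose j : ℝ) / 2 ^ (2 * r))) := by
  have hinv : Tendsto (fun q : ℕ => (1 : ℝ) / q) atTop (𝓝 0) :=
    tendsto_const_div_atTop_nhds_zero_nat 1
  have hne : ∀ᶠ q : ℕ in atTop, (q : ℝ) ≠ 0 :=
    (eventually_gt_atTop 0).mono fun q hq => by exact_mod_cast hq.ne'
  have h1 := tendsto_choose_div_pow (s := fun q => q + 1) (c := 1) (tendsto_add_atTop_nat 1)
    (by
      have := hinv.const_add 1
      rw [add_zero] at this
      refine this.congr' (hne.mono fun q hq => ?_)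
      push_cast
      field_simp) j
  have h2 := tendsto_choose_div_pow (s := fun q => q) (c := 1) tendsto_id
    (tendsto_const_nhds.congr' (hne.mono fun q hq => (div_self hq).symm)) (2 * r - j)
  have h3 := tendsto_choose_div_pow (s := fun q => 2 * q + 1) (c := 2)
    (tendsto_atTop_mono (fun q => by simp only [id]; omega) tendsto_id)
    (by
      have := hinv.const_add 2
      rw [add_zero] at this
      refine this.congr' (hne.mono fun q hq => ?_)
      push_cast
      field_simp) (2 * r)
  have h := (h1.mul h2).div h3 (by positivity)
  have hval : (1 : ℝ) ^ j / j.factorial * (1 ^ (2 * r - j) / (2 * r - j).factorial) /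
      (2 ^ (2 * r) / (2 * r).factorial) = ((2 * r).choose j : ℝ) / 2 ^ (2 * r) := by
    rw [Nat.cast_choose ℝ hj, one_pow, one_pow]
    field_simp
  rw [hval] at h
  refine h.congr' (hne.mono fun q hq => ?_)
  have hpow : (q : ℝ) ^ (2 * r) = q ^ j * q ^ (2 * r - j) := by
    rw [← pow_add, Nat.add_sub_cancel' hj]
  simp only [Pi.div_apply, hypergeom, hpow, Nat.cast_mul]
  field_simp

/-- As `min (2 * j) (2 * r) = 2 * r - max (2 * r - 2 * j) 0`, this computes the mean absolute
deviation of the binomial distribution. The terms `choose (2 * r) j * (2 * r - 2 * j)` telescope,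
being the differences of `j * choose (2 * r) j`. -/
theorem sum_choose_mul_min (r : ℕ) :
    ∑ j ∈ Finset.range (2 * r + 1), ((2 * r).choose j : ℝ) * (min (2 * j) (2 * r) : ℕ) =
      2 * r * 2 ^ (2 * r) - r * (2 * r).choose r := by
  have h1 : ∑ j ∈ Finset.range (2 * r + 1), ((2 * r).choose j : ℝ) = 2 ^ (2 * r) := by
    exact_mod_cast Nat.sum_range_choose (2 * r)
  have h2 : ∀ k ≤ r, ∑ j ∈ Finset.range k, ((2 * r).choose j : ℝ) * (2 * r - 2 * j) =
      k * (2 * r).choose k := by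
    intro k
    induction k with
    | zero => simp
    | succ k ih =>
      intro hk
      have h := Nat.choose_succ_right_eq (2 * r) k
      have h' : ((2 * r).choose (k + 1) : ℝ) * (k + 1) = (2 * r).choose k * (2 * r - k) := by
        have hc : ((2 * r - k : ℕ) : ℝ) = 2 * r - k := by
          rw [Nat.cast_sub (by omega)]
          push_cast
          ring
        rw [← hc]
        exact_mod_cast h
      rw [Finset.sum_range_succ, ih (by omega)]
      push_cast
      linear_combination -h'
  have h3 : ∑ j ∈ Finset.range (2 * r + 1),
      ((2 * r).choose j : ℝ) * (2 * r - (min (2 * j) (2 * r) : ℕ)) = r * (2 * r).choose r := by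
    rw [← h2 r le_rfl]
    symm
    refine Finset.sum_subset_zero_on_sdiff (Finset.range_subset_range.2 (by omega)) ?_ ?_
    · intro j hj
      simp only [Finset.mem_sdiff, Finset.mem_range] at hj
      rw [min_eq_right (by omega)]
      push_cast
      ring
    · intro j hj
      rw [Finset.mem_range] at hj
      rw [min_eq_left (by omega)]
      push_cast
      ring
  simp only [mul_sub] at h3
  rw [Finset.sum_sub_distrib, ← Finset.sum_mul, h1] at h3
  linear_combination -h3

theorem tendsto_FPT_div_FJCM {r : ℕ} (hr : 0 < r) :
    Tendsto (fun q : ℕ => (FPT q r : ℝ) / (FJCM (2 * q + 1) (2 * r) : ℝ)) atTop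
      (𝓝 (1 - 1 / 2 * (((2 * r).choose r : ℝ) / 2 ^ (2 * r)))) := by
  have hr' : (r : ℝ) ≠ 0 := by exact_mod_cast hr.ne'
  have h := tendsto_finsetSum (Finset.range (2 * r + 1)) fun j hj =>
    (tendsto_hypergeom_div r j (by simpa [Nat.lt_succ_iff] using hj)).mul_const
      ((min (2 * j) (2 * r) : ℕ) / (2 * r : ℝ))
  have hval : ∑ j ∈ Finset.range (2 * r + 1), ((2 * r).choose j : ℝ) / 2 ^ (2 * r) *
      ((min (2 * j) (2 * r) : ℕ) / (2 * r : ℝ)) =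
      1 - 1 / 2 * (((2 * r).choose r : ℝ) / 2 ^ (2 * r)) := by
    have hterm : ∀ j ∈ Finset.range (2 * r + 1), ((2 * r).choose j : ℝ) / 2 ^ (2 * r) *
        ((min (2 * j) (2 * r) : ℕ) / (2 * r : ℝ)) =
        ((2 * r).choose j : ℝ) * (min (2 * j) (2 * r) : ℕ) / (2 ^ (2 * r) * (2 * r)) :=
      fun j _ => by ring
    rw [Finset.sum_congr rfl hterm, ← Finset.sum_div, sum_choose_mul_min]
    field_simp
  rw [hval] at h
  refine h.congr fun q => ?_
  rw [FPT_eq_sum, FJCM, Nat.cast_sum, Finset.sum_div]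
  refine Finset.sum_congr rfl fun j _ => ?_
  push_cast
  ring

theorem choose_div_two_pow_succ (n : ℕ) :
    (2 * (n + 1)) * (((2 * (n + 1)).choose (n + 1) : ℝ) / 2 ^ (2 * (n + 1))) =
      (2 * n + 1) * (((2 * n).choose n : ℝ) / 2 ^ (2 * n)) := by
  have h : ((n : ℝ) + 1) * (2 * (n + 1)).choose (n + 1) = 2 * (2 * n + 1) * (2 * n).choose n := by
    exact_mod_cast Nat.succ_mul_centralBinom_succ n
  have hp : (2 : ℝ) ^ (2 * (n + 1)) = 4 * 2 ^ (2 * n) := by ring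
  rw [hp]
  field_simp
  linear_combination 2 * h

theorem choose_div_two_pow_sq_le (n : ℕ) :
    (((2 * n).choose n : ℝ) / 2 ^ (2 * n)) ^ 2 * (2 * n + 1) ≤ 1 := by
  induction n with
  | zero => simp
  | succ n ih =>
    have h := choose_div_two_pow_succ n
    set a := ((2 * n).choose n : ℝ) / 2 ^ (2 * n)
    set b := ((2 * (n + 1)).choose (n + 1) : ℝ) / 2 ^ (2 * (n + 1))
    clear_value a b
    refine le_trans ?_ ih
    have hb : b = (2 * n + 1) * a / (2 * (n + 1)) := by
      field_simp
      linear_combination h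
    rw [hb, div_pow, div_mul_eq_mul_div, div_le_iff₀ (by positivity)]
    push_cast
    have : 0 ≤ a ^ 2 * (2 * n + 1) := by positivity
    linear_combination this

theorem one_le_choose_div_two_pow_sq {n : ℕ} (hn : 1 ≤ n) :
    1 ≤ (((2 * n).choose n : ℝ) / 2 ^ (2 * n)) ^ 2 * (4 * n) := by
  induction n, hn using Nat.le_induction with
  | base => norm_num
  | succ n hn ih =>
    have h := choose_div_two_pow_succ n
    set a := ((2 * n).choose n : ℝ) / 2 ^ (2 * n)
    set b := ((2 * (n + 1)).choose (n + 1) : ℝ) / 2 ^ (2 * (n + 1))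
    clear_value a b
    refine le_trans ih ?_
    have hb : b = (2 * n + 1) * a / (2 * (n + 1)) := by
      field_simp
      linear_combination h
    rw [hb, div_pow, div_mul_eq_mul_div, le_div_iff₀ (by positivity)]
    push_cast
    have : 0 ≤ a ^ 2 * (4 * (n + 1)) := by positivity
    linear_combination this

theorem isTheta_choose_div_two_pow :
    (fun r : ℕ => 1 / 2 * (((2 * r).choose r : ℝ) / 2 ^ (2 * r))) =Θ[atTop]
      (fun r : ℕ => 1 / √((2 * r : ℕ) : ℝ)) := by
  have hsq : ∀ r : ℕ, 1 ≤ r → (1 / √((2 * r : ℕ) : ℝ)) ^ 2 * (2 * r) = 1 := by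
    intro r hr
    have hr' : (0 : ℝ) < r := by exact_mod_cast hr
    rw [div_pow, Real.sq_sqrt (by positivity)]
    push_cast
    field_simp
  refine ⟨IsBigO.of_bound 1 ?_, IsBigO.of_bound 4 ?_⟩
  · filter_upwards [eventually_ge_atTop 1] with r hr
    have hr' : (0 : ℝ) < r := by exact_mod_cast hr
    have h1 := choose_div_two_pow_sq_le r
    have h2 := hsq r hr
    rw [Real.norm_of_nonneg (by positivity), Real.norm_of_nonneg (by positivity), one_mul]
    have ha : (0 : ℝ) ≤ ((2 * r).choose r : ℝ) / 2 ^ (2 * r) := by positivity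
    set a := ((2 * r).choose r : ℝ) / 2 ^ (2 * r)
    refine le_trans (by linarith : 1 / 2 * a ≤ a) ?_
    refine le_of_sq_le_sq ?_ (by positivity)
    refine le_of_mul_le_mul_right ?_ (by positivity : (0 : ℝ) < 2 * r)
    rw [h2]
    linarith [sq_nonneg a]
  · filter_upwards [eventually_ge_atTop 1] with r hr
    have hr' : (0 : ℝ) < r := by exact_mod_cast hr
    have h1 := one_le_choose_div_two_pow_sq hr
    have h2 := hsq r hr
    rw [Real.norm_of_nonneg (by positivity), Real.norm_of_nonneg (by positivity)]
    have ha : (0 : ℝ) ≤ ((2 * r).choose r : ℝ) / 2 ^ (2 * r) := by positivity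
    set a := ((2 * r).choose r : ℝ) / 2 ^ (2 * r)
    refine le_of_sq_le_sq ?_ (by positivity)
    refine le_of_mul_le_mul_right ?_ (by positivity : (0 : ℝ) < 2 * r)
    rw [h2]
    have : 0 ≤ a ^ 2 * r := by positivity
    linear_combination h1 + 4 * this

/-! ### The scheme -/

theorem exists_scheme_with_FPT_packets {q r : ℕ} (hr : 0 < r) (hrq : r ≤ q) :
    ∃ L₀ : ℕ, 0 < L₀ ∧ ∀ L : ℕ, 0 < L → L₀ ∣ L →
      ∀ (N : ℕ) (M : ℝ), 0 < N → ((2 * q + 1 : ℕ) : ℝ) * M / N = ((2 * r : ℕ) : ℝ) →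
        ∃ S : D2DScheme N (2 * q + 1) L (FPT q r),
          S.HasMemory M ∧ S.IsCorrect ∧ S.IsOneShotMulticast (2 * r) ∧
            S.HasRate ((N : ℝ) / M - 1) := by
  obtain ⟨A, -, hA⟩ := Finset.exists_subset_card_eq
    (show q + 1 ≤ (Finset.univ : Finset (Fin (2 * q + 1))).card by simp; omega)
  have hAc : (Aᶜ).card = q := by
    rw [Finset.card_compl, hA, Fintype.card_fin]
    omega
  have hcard : Fintype.card (TwoClass.Packet A r) = FPT q r := by
    have h := TwoClass.sum_packet A r fun _ _ => 1
    rw [Finset.sum_const, Finset.card_univ, smul_eq_mul, mul_one] at h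
    rw [h, Finset.sum_congr rfl fun T hT => TwoClass.sum_slots_self A T r
      (Finset.mem_powersetCard.1 hT).2 fun _ => 1, TwoClass.sum_powersetCard_card_inter, FPT_eq_sum,
      hA, hAc]
    refine Finset.sum_congr rfl fun j hj => ?_
    rw [Finset.mem_range] at hj
    rw [Nat.cast_id, hypergeom, TwoClass.subfileSize]
    congr 1
    split_ifs <;> omega
  have hne : Nonempty (TwoClass.Packet A r) := by
    rw [← Fintype.card_pos_iff, hcard]
    exact FPT_pos hr hrq
  obtain ⟨x, hx, hbal⟩ := exists_packet_sizes hr hrq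
  refine ⟨∑ i : TwoClass.Packet A r, x i.1.2.2, Finset.sum_pos (fun i _ => hx _)
    Finset.univ_nonempty, ?_⟩
  rintro L hL ⟨c, rfl⟩ N M hN hM
  have hc : 0 < c := pos_of_mul_pos_right hL (Nat.zero_le _)
  obtain ⟨D, hhome, hlen⟩ := TwoClass.exists_design A r (fun b => x b * c)
    (fun b => Nat.mul_pos (hx b) hc) hne
  have hsum : ∑ i, D.len i = (∑ i : TwoClass.Packet A r, x i.1.2.2) * c := by
    rw [Finset.sum_mul]
    exact Finset.sum_congr rfl fun i _ => hlen i
  refine D.exists_scheme hcard hsum hL (by omega) (by omega) (by omega) (fun k => ?_) hN hM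
  have key := TwoClass.card_mul_sum_mem_eq A (2 * r) (fun j => (TwoClass.subfileSize r x j : ℤ))
    (by
      rw [hA, hAc, Fintype.card_fin, ← hbal]
      refine Finset.sum_congr rfl fun j _ => ?_
      rw [hypergeom, deviation]
      push_cast
      ring) k
  have h1 : ∑ i : TwoClass.Packet A r, x i.1.2.2 =
      ∑ T ∈ Finset.powersetCard (2 * r) Finset.univ, TwoClass.subfileSize r x (T ∩ A).card := by
    rw [TwoClass.sum_packet A r fun _ b => x b]
    exact Finset.sum_congr rfl fun T hT =>
      TwoClass.sum_slots_self A T r (Finset.mem_powersetCard.1 hT).2 x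
  have h2 : ∑ i with k ∈ D.home i, D.len i =
      (∑ T ∈ Finset.powersetCard (2 * r) Finset.univ with k ∈ T,
        TwoClass.subfileSize r x (T ∩ A).card) * c := by
    rw [Finset.sum_filter, Finset.sum_filter, Finset.sum_mul]
    simp only [hhome, hlen]
    rw [TwoClass.sum_packet A r fun T b => if k ∈ T then x b * c else 0]
    refine Finset.sum_congr rfl fun T hT => ?_
    split_ifs
    · rw [← Finset.sum_mul, TwoClass.sum_slots_self A T r (Finset.mem_powersetCard.1 hT).2 x]
    · simp
  rw [h1, h2, ← mul_assoc, ← mul_assoc]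
  congr 1
  rw [Fintype.card_fin] at key
  exact_mod_cast key

theorem theorem1 :
    (∀ q r : ℕ, 0 < r → r ≤ q →
      FPT q r ≤ FJCM (2 * q + 1) (2 * r) ∧
      ∃ L₀ : ℕ, 0 < L₀ ∧ ∀ L : ℕ, 0 < L → L₀ ∣ L →
        ∀ (N : ℕ) (M : ℝ), 0 < N → ((2 * q + 1 : ℕ) : ℝ) * M / N = ((2 * r : ℕ) : ℝ) →
          ∃ S : D2DScheme N (2 * q + 1) L (FPT q r),
            S.HasMemory M ∧ S.IsCorrect ∧ S.IsOneShotMulticast (2 * r) ∧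
              S.HasRate ((N : ℝ) / M - 1)) ∧
    (∀ r : ℕ, 0 < r →
      Tendsto (fun q : ℕ => (FPT q r : ℝ) / (FJCM (2 * q + 1) (2 * r) : ℝ)) atTop
        (𝓝 (1 - 1 / 2 * (((2 * r).choose r : ℝ) / 2 ^ (2 * r))))) ∧
    (fun r : ℕ => 1 / 2 * (((2 * r).choose r : ℝ) / 2 ^ (2 * r))) =Θ[atTop]
      (fun r : ℕ => 1 / √((2 * r : ℕ) : ℝ)) :=
  ⟨fun q r hr hrq => ⟨FPT_le_FJCM q r, exists_scheme_with_FPT_packets hr hrq⟩,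
    fun _ hr => tendsto_FPT_div_FJCM hr, isTheta_choose_div_two_pow⟩
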